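/- **Theorem 1.1.** Let $B$ be a unital commutative semisimple complex Banach algebra whose maximal ideal space $X$ (the space of characters of $B$ with the weak-* topology) is connected. Let $T:B\to B$ be an endomorphism of $B$ (a linear map with $T(fg)=(Tf)(Tg)$ for all $f,g\in B$) which is a Riesz operator and which is induced by a selfmap $\varphi$ of $X$, that is, $\widehat{Tf}(x)=\hat f(\varphi(x))$ for all $f\in B$ and $x\in X$, where $\hat f$ is the Gelfand transform of $f$. Then there is a point $x_0\in X$ such that $$\bigcap_{n=0}^\infty \varphi_n(X)=\{x_0\},$$ where $\varphi_n$ denotes the $n$-th iterate of $\varphi$, and $x_0$ is the unique fixed point of $\varphi$. Here a Riesz operator on a complex Banach space $B$ is a bounded linear operator $T:B\to B$ such that, for every complex $\lambda\neq 0$, with $N(\cdot)$ the null space and $R(\cdot)$ the range: (a) $\lambda-T$ is an open map of $B$ onto its range $R(\lambda-T)$ (with the relative topology); (b) $R(\lambda-T)$ is closed; (c) $\dim N(\lambda-T)$ and $\operatorname{codim} R(\lambda-T)$ are finite and equal; (d) the null chain $N((\lambda-T)^n)$ and the image chain $R((\lambda-T)^n)$, $n=0,1,2,\dots$, have finite and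 equal lengths, the length being the least $n$ at which the $n$-th and $(n+1)$-st terms agree; and such that (e) every non-zero point of the spectrum of $T$ is an eigenvalue and, if there are infinitely many of these, they form a sequence converging to $0$. -/

import Mathlib

open Topology

/-- A bounded linear operator `T` on a complex Banach space `E` is a *Riesz operator* if it satisfies
the conditions (a)-(e) below. -/
structure IsRieszOperator {E : Type*} [NormedAddCommGroup E] [NormedSpace ℂ E]
    (T : E →L[ℂ] E) : Prop where
  /-- (a) For each `μ ≠ 0`, `μ - T` is an open map onto its range (in the relative topology). -/
  isOpenMap_rangeRestrict : ∀ μ : ℂ, μ ≠ 0 →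
    IsOpenMap ((μ • (1 : E →L[ℂ] E) - T : E →L[ℂ] E) : E →ₗ[ℂ] E).rangeRestrict
  /-- (b) For each `μ ≠ 0`, the range of `μ - T` is closed. -/
  isClosed_range : ∀ μ : ℂ, μ ≠ 0 →
    IsClosed (Set.range (μ • (1 : E →L[ℂ] E) - T : E →L[ℂ] E))
  /-- (c) For each `μ ≠ 0`, the dimension of the kernel of `μ - T` and the codimension of its range
  are finite and equal. -/
  finite_dim_ker_eq_codim_range : ∀ μ : ℂ, μ ≠ 0 →
    let S : E →ₗ[ℂ] E := (μ • (1 : E →L[ℂ] E) - T : E →L[ℂ] E)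
    FiniteDimensional ℂ (LinearMap.ker S) ∧ FiniteDimensional ℂ (E ⧸ LinearMap.range S) ∧
      Module.finrank ℂ (LinearMap.ker S) = Module.finrank ℂ (E ⧸ LinearMap.range S)
  /-- (d) For each `μ ≠ 0`, the lengths of the null chain and of the image chain of `μ - T`
  are finite and equal. -/
  ascent_eq_descent : ∀ μ : ℂ, μ ≠ 0 →
    let S : Module.End ℂ E := ((μ • (1 : E →L[ℂ] E) - T : E →L[ℂ] E) : E →ₗ[ℂ] E)
    ∃ p : ℕ,
      IsLeast {n : ℕ | LinearMap.ker (S ^ n) = LinearMap.ker (S ^ (n + 1))} p ∧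
      IsLeast {n : ℕ | LinearMap.range (S ^ n) = LinearMap.range (S ^ (n + 1))} p
  /-- (e) Every non-zero point of the spectrum is an eigenvalue ... -/
  hasEigenvalue_of_mem_spectrum : ∀ μ ∈ spectrum ℂ T, μ ≠ 0 →
    Module.End.HasEigenvalue (T : E →ₗ[ℂ] E) μ
  /-- (e, continued) ... and if there are infinitely many of them, they form a sequence
  approaching `0`. -/
  exists_seq_tendsto_zero : (spectrum ℂ T \ {0}).Infinite →
    ∃ u : ℕ → ℂ, Function.Injective u ∧ Set.range u = spectrum ℂ T \ {0} ∧
      Filter.Tendsto u Filter.atTop (𝓝 0)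

/-- The selfmap `φ` of the maximal ideal space (the space of characters) of `B` induces the
operator `T`: the Gelfand transforms satisfy `(T f)^(x) = f^(φ x)` for all `f` and `x`. -/
def Induces {B : Type*} [NormedCommRing B] [NormedAlgebra ℂ B]
    (φ : WeakDual.characterSpace ℂ B → WeakDual.characterSpace ℂ B) (T : B →L[ℂ] B) : Prop :=
  ∀ (f : B) (x : WeakDual.characterSpace ℂ B), x (T f) = (φ x) f

open Filter WeakDual

/-! For each `f`, the powers `T ^ n f` converge in norm to a scalar, so by `Induces.apply_pow` the
iterates of `φ` converge to one character, uniformly in the starting point on each `f`. Fixed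
vectors of `T` form a finite-dimensional algebra; their Gelfand transforms take finitely many values
and are constant by connectedness. Powers of an eigenvector with `1 ≤ ‖z‖` have eigenvalues `z ^ n`;
finiteness makes `z` a root of unity, and then `z = 1`. This eigenvalue is semisimple, so a Riesz
operator splits each vector into a fixed part and a part in the range of `1 - T`, where the spectral
radius is below one. -/

/-- In a complex Banach algebra, the powers of an element of spectral radius less than one
tend to zero. -/
theorem tendsto_pow_atTop_nhds_zero_of_spectralRadius_lt_one {A : Type*} [NormedRing A]
    [NormedAlgebra ℂ A] [CompleteSpace A] {a : A} (ha : spectralRadius ℂ a < 1) :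
    Tendsto (fun n : ℕ => a ^ n) atTop (𝓝 0) := by
  obtain ⟨r, har, hr1⟩ := ENNReal.lt_iff_exists_nnreal_btwn.mp ha
  have hr : r < 1 := by exact_mod_cast hr1
  have hev : ∀ᶠ n : ℕ in atTop, ‖a ^ n‖ ≤ (r : ℝ) ^ n := by
    filter_upwards [(spectrum.pow_nnnorm_pow_one_div_tendsto_nhds_spectralRadius a).eventually
      (gt_mem_nhds har), eventually_gt_atTop 0] with n hn hn0
    have hn0' : (0 : ℝ) < n := by exact_mod_cast hn0
    have h := ENNReal.rpow_le_rpow hn.le hn0'.le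
    rw [← ENNReal.rpow_mul, one_div_mul_cancel hn0'.ne', ENNReal.rpow_one,
      ENNReal.rpow_natCast] at h
    exact_mod_cast h
  exact squeeze_zero_norm' hev
    (tendsto_pow_atTop_nhds_zero_of_lt_one r.2 (by exact_mod_cast hr))

theorem spectralRadius_lt_one_of_forall_norm_lt_one {A : Type*} [NormedRing A]
    [NormedAlgebra ℂ A] [CompleteSpace A] {a : A} (ha : ∀ z ∈ spectrum ℂ a, ‖z‖ < 1) :
    spectralRadius ℂ a < 1 := by
  rcases (spectrum ℂ a).eq_empty_or_nonempty with h | h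
  · simp [spectralRadius, h]
  · have := spectrum.spectralRadius_lt_of_forall_lt_of_nonempty (r := 1) h
      fun z hz => by exact_mod_cast ha z hz
    simpa using this

/-! ### Gelfand theory of semisimple algebras -/

section Semisimple

variable {B : Type*} [NormedCommRing B] [NormedAlgebra ℂ B] [CompleteSpace B]

/-- An element of a semisimple commutative Banach algebra with vanishing Gelfand transform
is zero. -/
theorem eq_zero_of_forall_character_apply_eq_zero (hss : Ring.jacobson B = ⊥) {f : B}
    (hf : ∀ x : characterSpace ℂ B, x f = 0) : f = 0 := by
  have hmem : f ∈ Ideal.jacobson (⊥ : Ideal B) := by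
    refine Ideal.mem_jacobson_bot.mpr fun g => ?_
    by_contra hg
    -- A non-unit `f * g + 1` is killed by some character, yet every character sends it to `1`.
    obtain ⟨x, hx⟩ := CharacterSpace.exists_apply_eq_zero hg
    simp [hf x] at hx
  rw [Ideal.jacobson_bot, hss] at hmem
  simpa using hmem

theorem eq_of_forall_character_apply_eq (hss : Ring.jacobson B = ⊥) {f g : B}
    (h : ∀ x : characterSpace ℂ B, x f = x g) : f = g :=
  sub_eq_zero.mp <| eq_zero_of_forall_character_apply_eq_zero hss fun x => by simp [h x]

/-- In a semisimple commutative Banach algebra with connected maximal ideal space, every integral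
element is a scalar. -/
theorem exists_eq_algebraMap_of_isIntegral (hss : Ring.jacobson B = ⊥)
    [ConnectedSpace (characterSpace ℂ B)] {f : B} (hf : IsIntegral ℂ f) :
    ∃ c : ℂ, f = algebraMap ℂ B c := by
  obtain ⟨p, hp, hpf⟩ := hf
  have hcont : Continuous fun x : characterSpace ℂ B => x f :=
    (WeakDual.eval_continuous f).comp continuous_subtype_val
  have hsub : Set.range (fun x : characterSpace ℂ B => x f) ⊆ (p.roots.toFinset : Set ℂ) := by
    rintro _ ⟨x, rfl⟩
    have h := congrArg x hpf
    rw [← Polynomial.aeval_def, ← Polynomial.aeval_algHom_apply, map_zero] at h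
    simpa [Polynomial.mem_roots hp.ne_zero] using h
  have hfin := (p.roots.toFinset.finite_toSet.subset hsub).countable.isTotallyDisconnected _
    subset_rfl (isPreconnected_range hcont)
  obtain ⟨x₁⟩ : Nonempty (characterSpace ℂ B) := inferInstance
  refine ⟨x₁ f, eq_of_forall_character_apply_eq hss fun x => ?_⟩
  rw [AlgHomClass.commutes]
  exact hfin ⟨x, rfl⟩ ⟨x₁, rfl⟩

end Semisimple

/-! ### Riesz operators and convergence of their powers -/

section Riesz

variable {E : Type*} [NormedAddCommGroup E] [NormedSpace ℂ E] {T : E →L[ℂ] E}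

theorem IsRieszOperator.finite_one_le_norm_spectrum (hT : IsRieszOperator T) :
    {z ∈ spectrum ℂ T | 1 ≤ ‖z‖}.Finite := by
  have hsub : {z ∈ spectrum ℂ T | 1 ≤ ‖z‖} ⊆ spectrum ℂ T \ {0} := by
    rintro z ⟨hz, hz1⟩
    refine ⟨hz, ?_⟩
    rintro rfl
    norm_num at hz1
  by_cases hinf : (spectrum ℂ T \ {0}).Infinite
  · obtain ⟨u, -, hu, hlim⟩ := hT.exists_seq_tendsto_zero hinf
    have hev : ∀ᶠ n in atTop, ‖u n‖ < 1 := by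
      have := hlim.norm
      rw [norm_zero] at this
      exact this.eventually (gt_mem_nhds one_pos)
    obtain ⟨N, hN⟩ := eventually_atTop.mp hev
    refine ((Set.finite_Iio N).image u).subset fun z hz => ?_
    obtain ⟨n, rfl⟩ : z ∈ Set.range u := hu ▸ hsub hz
    refine ⟨n, ?_, rfl⟩
    by_contra hn
    exact (hN n (not_lt.mp hn)).not_ge hz.2
  · exact (Set.not_infinite.mp hinf).subset hsub

/-- If the eigenvalue `1` of a Riesz operator `T` is semisimple, then `1 - T` and its square have
the same range. -/
theorem IsRieszOperator.exists_sub_apply_sub_apply_eq (hT : IsRieszOperator T)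
    (hker : ∀ f g : E, f - T f = g → T g = g → g = 0) (f : E) :
    ∃ g : E, (g - T g) - T (g - T g) = f - T f := by
  obtain ⟨p, hp, hp'⟩ := hT.ascent_eq_descent 1 one_ne_zero
  set S : Module.End ℂ E := (((1 : ℂ) • (1 : E →L[ℂ] E) - T : E →L[ℂ] E) : E →ₗ[ℂ] E) with hS
  have hSapp : ∀ f, S f = f - T f := fun f => by simp [hS]
  have hp1 : p ≤ 1 := by
    refine hp.2 ?_
    change LinearMap.ker (S ^ 1) = LinearMap.ker (S ^ 2)
    ext f
    simp only [LinearMap.mem_ker, pow_two, pow_one, Module.End.mul_apply]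
    refine ⟨fun h => by rw [h, map_zero], fun h => ?_⟩
    rw [hSapp (S f), sub_eq_zero] at h
    exact hker f (S f) (hSapp f).symm h.symm
  have hrange : LinearMap.range (S ^ p) = LinearMap.range (S ^ (p + 1)) := hp'.1
  simp only [← hSapp]
  -- If `p = 0`, then `S` is surjective; if `p = 1`, the ranges of `S` and `S ^ 2` agree.
  interval_cases p
  · have h1 : f ∈ LinearMap.range (S ^ 0) := ⟨f, rfl⟩
    rw [hrange] at h1
    obtain ⟨g, hg⟩ := h1
    refine ⟨g, ?_⟩
    rw [← hg, zero_add, pow_one]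
  · have h1 : S f ∈ LinearMap.range (S ^ 1) := ⟨f, by rw [pow_one]⟩
    rw [hrange] at h1
    obtain ⟨g, hg⟩ := h1
    exact ⟨g, by rw [← hg, one_add_one_eq_two, pow_two, Module.End.mul_apply]⟩

variable [CompleteSpace E]

theorem tendsto_pow_apply_nhds_zero_of_spectrum (hspec : ∀ z ∈ spectrum ℂ T, ‖z‖ < 1) (f : E) :
    Tendsto (fun n : ℕ => (T ^ n) f) atTop (𝓝 0) := by
  have hpow := tendsto_pow_atTop_nhds_zero_of_spectralRadius_lt_one
    (spectralRadius_lt_one_of_forall_norm_lt_one hspec)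
  have h := ((ContinuousLinearMap.apply ℂ E f).continuous.tendsto 0).comp hpow
  rwa [map_zero] at h

/-- If `z - T` restricts to a bijection of the closed invariant subspace `M` whenever `1 ≤ ‖z‖`,
then the powers of `T` tend to zero pointwise on `M`. -/
theorem tendsto_pow_apply_nhds_zero_of_mem (M : Submodule ℂ E) (hclosed : IsClosed (M : Set E))
    (hTM : ∀ m ∈ M, T m ∈ M)
    (hinj : ∀ z : ℂ, 1 ≤ ‖z‖ → ∀ m ∈ M, T m = z • m → m = 0)
    (hsurj : ∀ z : ℂ, 1 ≤ ‖z‖ → ∀ m ∈ M, ∃ m' ∈ M, z • m' - T m' = m) {m : E} (hm : m ∈ M) :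
    Tendsto (fun n : ℕ => (T ^ n) m) atTop (𝓝 0) := by
  have : CompleteSpace M := hclosed.completeSpace_coe
  obtain ⟨R, hR⟩ : ∃ R : M →L[ℂ] M, ∀ m : M, (R m : E) = T m :=
    ⟨(T.comp M.subtypeL).codRestrict M fun m => hTM m m.2, fun _ => rfl⟩
  have hspec : ∀ z ∈ spectrum ℂ R, ‖z‖ < 1 := by
    intro z hz
    by_contra! hz1
    refine hz (ContinuousLinearMap.isUnit_iff_bijective.mpr ?_)
    have happ : ∀ m : M, ((algebraMap ℂ (M →L[ℂ] M) z - R) m : E) = z • (m : E) - T m := by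
      intro m
      simp [Algebra.algebraMap_eq_smul_one, hR]
    constructor
    · refine (injective_iff_map_eq_zero _).mpr fun m hm => Subtype.ext (hinj z hz1 m m.2 ?_)
      have := happ m
      rw [hm, ZeroMemClass.coe_zero] at this
      exact (sub_eq_zero.mp this.symm).symm
    · intro m
      obtain ⟨m', hm', h⟩ := hsurj z hz1 m m.2
      exact ⟨⟨m', hm'⟩, Subtype.ext ((happ _).trans h)⟩
  have hpow : ∀ n : ℕ, ((R ^ n) ⟨m, hm⟩ : E) = (T ^ n) m := by
    intro n
    induction n with
    | zero => simp
    | succ n ih => rw [pow_succ', pow_succ', mul_apply_eq_comp, mul_apply_eq_comp, hR, ih]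
  have h := (M.subtypeL.continuous.tendsto _).comp
    (tendsto_pow_apply_nhds_zero_of_spectrum hspec ⟨m, hm⟩)
  rw [map_zero] at h
  exact h.congr hpow

/-- If `1` is the only eigenvalue of modulus at least one of a Riesz operator, and it is
semisimple, then the powers of the operator converge pointwise to fixed vectors. -/
theorem IsRieszOperator.exists_tendsto_pow_apply (hT : IsRieszOperator T)
    (hev : ∀ z : ℂ, 1 ≤ ‖z‖ → ∀ f : E, f ≠ 0 → T f = z • f → z = 1)
    (hker : ∀ f g : E, f - T f = g → T g = g → g = 0) (f : E) :
    ∃ g : E, T g = g ∧ Tendsto (fun n : ℕ => (T ^ n) f) atTop (𝓝 g) := by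
  obtain ⟨S, hS⟩ : ∃ S : E →L[ℂ] E, S = (1 : ℂ) • (1 : E →L[ℂ] E) - T := ⟨_, rfl⟩
  have hSapp : ∀ f, S f = f - T f := fun f => by simp [hS]
  have hcomm : ∀ f, T (S f) = S (T f) := fun f => by simp [hSapp]
  have hclosed : IsClosed ((LinearMap.range (S : E →ₗ[ℂ] E) : Submodule ℂ E) : Set E) := by
    have := hT.isClosed_range 1 one_ne_zero
    rwa [← hS] at this
  have hrange : ∀ f, ∃ g, S (S g) = S f := by
    intro f
    obtain ⟨g, hg⟩ := hT.exists_sub_apply_sub_apply_eq hker f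
    exact ⟨g, by simp only [hSapp, hg]⟩
  have hinj : ∀ z : ℂ, 1 ≤ ‖z‖ → ∀ m ∈ LinearMap.range (S : E →ₗ[ℂ] E),
      T m = z • m → m = 0 := by
    rintro z hz1 _ ⟨g, rfl⟩ hm
    by_contra hm0
    obtain rfl := hev z hz1 _ hm0 hm
    exact hm0 (hker g (S g) (hSapp g).symm (hm.trans (one_smul ℂ _)))
  have hsurj : ∀ z : ℂ, 1 ≤ ‖z‖ → ∀ m ∈ LinearMap.range (S : E →ₗ[ℂ] E),
      ∃ m' ∈ LinearMap.range (S : E →ₗ[ℂ] E), z • m' - T m' = m := by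
    rintro z hz1 _ ⟨f, rfl⟩
    by_cases hz' : z = 1
    · obtain ⟨g, hg⟩ := hrange f
      refine ⟨S g, ⟨g, rfl⟩, ?_⟩
      rw [hz', one_smul, ← hSapp]
      exact hg
    · have hz0 : z ≠ 0 := by
        rintro rfl
        norm_num at hz1
      have hns : z ∉ spectrum ℂ T := fun hzs => by
        obtain ⟨v, hv⟩ := (hT.hasEigenvalue_of_mem_spectrum z hzs hz0).exists_hasEigenvector
        exact hz' (hev z hz1 v hv.2 hv.apply_eq_smul)
      -- Solve in all of `E`, then apply `S`, which commutes with `T`.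
      obtain ⟨g, hg⟩ :=
        (ContinuousLinearMap.isUnit_iff_bijective.mp (spectrum.notMem_iff.mp hns)).2 f
      refine ⟨S g, ⟨g, rfl⟩, ?_⟩
      rw [hcomm, ← map_smul, ← map_sub, ← hg]
      simp [Algebra.algebraMap_eq_smul_one]
  -- Splits `f` as `(f - S g) + S g`, with the first term in the kernel of `S`.
  obtain ⟨g, hg⟩ := hrange f
  have hfix : T (f - S g) = f - S g := by
    have : S (f - S g) = 0 := by rw [map_sub, hg, sub_self]
    rw [hSapp, sub_eq_zero] at this
    exact this.symm
  have hpowfix : ∀ n : ℕ, (T ^ n) (f - S g) = f - S g := by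
    intro n
    induction n with
    | zero => simp
    | succ n ih => rw [pow_succ, mul_apply_eq_comp, hfix, ih]
  have h := (tendsto_pow_apply_nhds_zero_of_mem _ hclosed
    (by rintro _ ⟨f, rfl⟩; exact ⟨T f, (hcomm f).symm⟩) hinj hsurj
    (LinearMap.mem_range_self (S : E →ₗ[ℂ] E) g)).const_add (f - S g)
  rw [add_zero] at h
  refine ⟨f - S g, hfix, h.congr fun n => ?_⟩
  conv_lhs => rw [← hpowfix n]
  rw [← map_add]
  exact congrArg (T ^ n) (sub_add_cancel f (S g))

end Riesz

/-! ### Multiplicative Riesz operators -/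

section Endomorphism

variable {B : Type*} [NormedCommRing B] [NormedAlgebra ℂ B]
  {T : B →L[ℂ] B} {φ : characterSpace ℂ B → characterSpace ℂ B}

theorem Induces.apply_pow (hφ : Induces φ T) (n : ℕ) (f : B) (x : characterSpace ℂ B) :
    x ((T ^ n) f) = (φ^[n] x) f := by
  induction n generalizing x with
  | zero => simp
  | succ n ih =>
    rw [pow_succ', mul_apply_eq_comp, hφ, ih, Function.iterate_succ_apply]

/-- Multiplicativity makes the kernel of `1 - T` a subalgebra, and it is finite-dimensional. -/
theorem IsRieszOperator.isIntegral_of_apply_eq_self (hT : IsRieszOperator T)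
    (hmul : ∀ f g : B, T (f * g) = T f * T g) (hone : T 1 = 1) {f : B} (hf : T f = f) :
    IsIntegral ℂ f := by
  let F : B →ₐ[ℂ] B := AlgHom.ofLinearMap (T : B →ₗ[ℂ] B) hone hmul
  let A : Subalgebra ℂ B := AlgHom.equalizer F (AlgHom.id ℂ B)
  have hA : Subalgebra.toSubmodule A =
      LinearMap.ker (((1 : ℂ) • (1 : B →L[ℂ] B) - T : B →L[ℂ] B) : B →ₗ[ℂ] B) := by
    ext g
    simp only [A, F, Subalgebra.mem_toSubmodule, AlgHom.mem_equalizer, LinearMap.mem_ker]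
    simpa [eq_comm] using (sub_eq_zero (a := g) (b := T g)).symm
  have hfin := (hT.finite_dim_ker_eq_codim_range 1 one_ne_zero).1
  refine IsIntegral.of_mem_of_fg A ?_ f (by simpa [A, F] using hf)
  rw [hA]
  exact Module.Finite.iff_fg.mp hfin

variable [CompleteSpace B]

theorem Induces.map_one (hss : Ring.jacobson B = ⊥) (hφ : Induces φ T) : T 1 = 1 :=
  eq_of_forall_character_apply_eq hss fun x => by rw [hφ, _root_.map_one, _root_.map_one]

variable [ConnectedSpace (characterSpace ℂ B)]

theorem IsRieszOperator.eq_one_of_one_le_norm (hss : Ring.jacobson B = ⊥)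
    (hT : IsRieszOperator T) (hmul : ∀ f g : B, T (f * g) = T f * T g) (hone : T 1 = 1)
    {z : ℂ} (hz : 1 ≤ ‖z‖) {f : B} (hf : f ≠ 0) (hfz : T f = z • f) : z = 1 := by
  have hz0 : z ≠ 0 := by
    rintro rfl
    norm_num at hz
  have hpow : ∀ n : ℕ, T (f ^ n) = z ^ n • f ^ n := by
    intro n
    induction n with
    | zero => simp [hone]
    | succ n ih => rw [pow_succ, hmul, ih, hfz, smul_mul_smul_comm, ← pow_succ]
  have hf_pow : ∀ n : ℕ, f ^ n ≠ 0 := by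
    intro n hn
    refine hf (eq_zero_of_forall_character_apply_eq_zero hss fun x => ?_)
    have := congrArg x hn
    rw [map_pow, map_zero] at this
    exact eq_zero_of_pow_eq_zero this
  have hspec : ∀ n : ℕ, z ^ n ∈ {w ∈ spectrum ℂ T | 1 ≤ ‖w‖} := by
    intro n
    refine ⟨fun hu => hf_pow n ?_, by rw [norm_pow]; exact one_le_pow₀ hz⟩
    refine (ContinuousLinearMap.isUnit_iff_bijective.mp hu).1 ?_
    simp [Algebra.algebraMap_eq_smul_one, hpow]
  have hninj : ¬ Function.Injective fun n : ℕ => z ^ n := fun hinj =>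
    Set.infinite_of_injective_forall_mem hinj hspec hT.finite_one_le_norm_spectrum
  obtain ⟨n, hn, hzn⟩ : ∃ n : ℕ, 0 < n ∧ z ^ n = 1 := by
    simp only [Function.Injective] at hninj
    push Not at hninj
    obtain ⟨a, b, hab, hne⟩ := hninj
    wlog hlt : a < b generalizing a b
    · exact this b a hab.symm hne.symm (by omega)
    refine ⟨b - a, by omega, ?_⟩
    rw [pow_sub₀ z hz0 hlt.le, ← hab, mul_inv_cancel₀ (pow_ne_zero a hz0)]
  -- `f ^ n` is fixed by `T`, so `f` is integral, hence a scalar, hence itself fixed.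
  have hint : IsIntegral ℂ f := IsIntegral.of_pow hn <|
    hT.isIntegral_of_apply_eq_self hmul hone (by rw [hpow, hzn, one_smul])
  obtain ⟨c, rfl⟩ := exists_eq_algebraMap_of_isIntegral hss hint
  have hTc : T (algebraMap ℂ B c) = algebraMap ℂ B c := by
    rw [Algebra.algebraMap_eq_smul_one, map_smul, hone]
  rw [hTc] at hfz
  have h0 : (z - 1) • algebraMap ℂ B c = 0 := by rw [sub_smul, one_smul, ← hfz, sub_self]
  exact sub_eq_zero.mp ((smul_eq_zero.mp h0).resolve_right hf)

end Endomorphism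

theorem theorem1p1 {B : Type*} [NormedCommRing B] [NormedAlgebra ℂ B] [CompleteSpace B]
    (hss : Ring.jacobson B = ⊥)
    [ConnectedSpace (WeakDual.characterSpace ℂ B)]
    (T : B →L[ℂ] B) (hmul : ∀ f g : B, T (f * g) = T f * T g)
    (hT : IsRieszOperator T)
    (φ : WeakDual.characterSpace ℂ B → WeakDual.characterSpace ℂ B)
    (hφ : Induces φ T) :
    ∃ x₀ : WeakDual.characterSpace ℂ B,
      (⋂ n : ℕ, Set.range (φ^[n])) = {x₀} ∧ φ x₀ = x₀ ∧
        ∀ x : WeakDual.characterSpace ℂ B, φ x = x → x = x₀ := by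
  have hone := hφ.map_one hss
  have hscalar : ∀ g : B, T g = g → ∃ c : ℂ, g = algebraMap ℂ B c := fun g hg =>
    exists_eq_algebraMap_of_isIntegral hss (hT.isIntegral_of_apply_eq_self hmul hone hg)
  obtain ⟨x₁⟩ : Nonempty (characterSpace ℂ B) := inferInstance
  -- The norm of `1` is not assumed to be one.
  have hbound : ∀ (x : characterSpace ℂ B) (f : B), ‖x f‖ ≤ ‖f‖ * ‖(1 : B)‖ := fun x f =>
    AlgHom.norm_apply_le_self_mul_norm_one x f
  -- If `f - T f = c` is a nonzero scalar, the values of `f` along an orbit drift by `-c` at each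
  -- step, against boundedness.
  have hker : ∀ f g : B, f - T f = g → T g = g → g = 0 := by
    intro f g hfg hg
    obtain ⟨c, rfl⟩ := hscalar g hg
    have hTf : ∀ x : characterSpace ℂ B, (φ x) f = x f - c := fun x => by
      rw [← hφ, ← sub_eq_iff_eq_add'.mpr (sub_eq_iff_eq_add.mp hfg), map_sub,
        AlgHomClass.commutes]
      rfl
    have hiter : ∀ n : ℕ, (φ^[n] x₁) f = x₁ f - n * c := by
      intro n
      induction n with
      | zero => simp
      | succ n ih =>
        rw [Function.iterate_succ_apply', hTf, ih]
        push_cast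
        ring
    have hnc : ∀ n : ℕ, n * ‖c‖ ≤ ‖f‖ * ‖(1 : B)‖ + ‖f‖ * ‖(1 : B)‖ := by
      intro n
      have hc : (n : ℂ) * c = x₁ f - (φ^[n] x₁) f := by rw [hiter]; ring
      calc n * ‖c‖ = ‖(n : ℂ) * c‖ := by simp
        _ ≤ _ := by
          rw [hc]
          exact (norm_sub_le _ _).trans (add_le_add (hbound _ _) (hbound _ _))
    by_contra hc
    have hc' : 0 < ‖c‖ := norm_pos_iff.mpr fun h => hc (by rw [h, map_zero])
    obtain ⟨n, hn⟩ := exists_nat_gt ((‖f‖ * ‖(1 : B)‖ + ‖f‖ * ‖(1 : B)‖) / ‖c‖)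
    exact ((div_lt_iff₀ hc').mp hn).not_ge (hnc n)
  have hlim : ∀ f : B, ∃ c : ℂ,
      Tendsto (fun n : ℕ => (T ^ n) f) atTop (𝓝 (algebraMap ℂ B c)) := by
    intro f
    obtain ⟨g, hg, hgf⟩ := hT.exists_tendsto_pow_apply
      (fun z hz f hf hfz => hT.eq_one_of_one_le_norm hss hmul hone hz hf hfz) hker f
    obtain ⟨c, rfl⟩ := hscalar g hg
    exact ⟨c, hgf⟩
  -- A cluster point of one orbit turns the limit scalars into values of a character.
  obtain ⟨x₀, hx₀⟩ := exists_clusterPt_of_compactSpace (map (fun n => φ^[n] x₁) atTop)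
  have hcont : ∀ f : B, Continuous fun x : characterSpace ℂ B => x f := fun f =>
    (WeakDual.eval_continuous f).comp continuous_subtype_val
  have hlim₀ : ∀ f : B,
      Tendsto (fun n : ℕ => (T ^ n) f) atTop (𝓝 (algebraMap ℂ B (x₀ f))) := by
    intro f
    obtain ⟨c, hc⟩ := hlim f
    have h1 : Tendsto (fun n : ℕ => (φ^[n] x₁) f) atTop (𝓝 c) := by
      have h2 := ((map_continuous x₁).tendsto _).comp hc
      rw [AlgHomClass.commutes] at h2
      exact h2.congr fun n => hφ.apply_pow n f x₁
    have h3 : MapClusterPt (x₀ f) atTop fun n : ℕ => (φ^[n] x₁) f :=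
      MapClusterPt.continuousAt_comp (u := fun n => φ^[n] x₁) (hcont f).continuousAt hx₀
    have h4 : x₀ f = c := by
      have : (𝓝 (x₀ f) ⊓ 𝓝 c).NeBot := h3.clusterPt.mono h1
      exact eq_of_nhds_neBot this
    rwa [h4]
  have hchar : ∀ y : characterSpace ℂ B, (∀ n : ℕ, ∃ x, φ^[n] x = y) → y = x₀ := by
    intro y hy
    choose x hx using hy
    refine CharacterSpace.ext fun f => ?_
    have h0 : Tendsto (fun n : ℕ => ‖(T ^ n) f - algebraMap ℂ B (x₀ f)‖ * ‖(1 : B)‖)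
        atTop (𝓝 0) := by
      simpa using ((tendsto_iff_norm_sub_tendsto_zero.mp (hlim₀ f)).mul_const ‖(1 : B)‖)
    -- The bound does not depend on the preimage `x n`, so the preimages may vary freely with `n`.
    have hle : ‖y f - x₀ f‖ ≤ 0 := ge_of_tendsto' h0 fun n => by
      have := hbound (x n) ((T ^ n) f - algebraMap ℂ B (x₀ f))
      rwa [map_sub, AlgHomClass.commutes, hφ.apply_pow, hx] at this
    exact sub_eq_zero.mp (norm_le_zero_iff.mp hle)
  have hfixed : φ x₀ = x₀ := by
    refine CharacterSpace.ext fun f => ?_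
    rw [← hφ]
    have h1 := hlim₀ (T f)
    have h2 := (tendsto_add_atTop_iff_nat 1).mpr (hlim₀ f)
    simp only [pow_succ, mul_apply_eq_comp] at h2
    have h3 := congrArg x₀ (tendsto_nhds_unique h1 h2)
    simpa only [AlgHomClass.commutes, Algebra.algebraMap_self_apply] using h3
  refine ⟨x₀, Set.eq_singleton_iff_unique_mem.mpr ⟨?_, fun y hy => ?_⟩, hfixed, fun x hx => ?_⟩
  · exact Set.mem_iInter.mpr fun n => ⟨x₀, Function.iterate_fixed hfixed n⟩
  · exact hchar y fun n => Set.mem_iInter.mp hy n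
  · exact hchar x fun n => ⟨x, Function.iterate_fixed hx n⟩
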